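/- Let $\alpha>0$ and $\phi(x)=e^{-|x|^\alpha}$ for $x\in\mathbb R$. Write $$A(\mathbb R)=\Big\{x\mapsto\int_{-\infty}^{\infty} g(t)e^{-itx}\,dt \;:\; g\in L_1(\mathbb R)\Big\}$$ for the Wiener algebra of absolutely convergent Fourier integrals. Then: (a) $\phi$ has finite variation in some neighbourhood of $0$, $\phi(0)=1$, $x\phi(x)\in L_1(\mathbb R)$, $\phi\in A(\mathbb R)$, $\phi$ is differentiable at every $x\neq 0$, and the function $x\phi'(x)$ (with the value $0$ at $x=0$) belongs to $A(\mathbb R)\cap L_1(\mathbb R)$. (b) Let $f$ be a $2\pi$-periodic complex-valued function on $\mathbb R$, integrable on $[-\pi,\pi]$, with Fourier coefficients $\widehat f_k=\frac1{2\pi}\int_{-\pi}^{\pi}f(t)e^{-ikt}\,dt$, and let $x\in\mathbb R$ be a $d$-point of $f$, that is, a point at which $F(y)=\int_0^y f(t)\,dt$ has a finite derivative $d_f(x)=F'(x)$. Then the series below converge absolutely for every $n\ge 0$ and every $\varepsilon>0$, and $$\lim_{n\to\infty}\sum_{k=-\infty}^{\infty}\phi\Big(\frac{k}{n+1}\Big)\widehat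 f_k e^{ikx}=d_f(x),\qquad \lim_{\varepsilon\to 0+}\sum_{k=-\infty}^{\infty}\phi(\varepsilon k)\widehat f_k e^{ikx}=d_f(x).$$ -/

import Mathlib

open Real Complex MeasureTheory Filter Topology

/-- The Wiener algebra `A(ℝ)` of absolutely convergent Fourier integrals: the functions
`f(x) = ∫ g(t) e^{-itx} dt` (for every `x`) with `g ∈ L₁(ℝ)`. -/
def MemWienerAlgebra (f : ℝ → ℂ) : Prop :=
  ∃ g : ℝ → ℂ, Integrable g ∧
    ∀ x : ℝ, f x = ∫ t : ℝ, g t * Complex.exp (-(Complex.I * (t : ℂ) * (x : ℂ)))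

/-- The conditions on a multiplier function `φ`: it has finite variation in a neighbourhood of `0`,
`φ(0) = 1`, `x φ(x) ∈ L₁(ℝ)`, `φ ∈ A(ℝ)`, and `x φ'(x) ∈ A(ℝ) ∩ L₁(ℝ)`.

The derivative is required to exist at every `x ≠ 0`; at `x = 0`, where `φ'` need not exist,
the function `x φ'(x)` has the value `0`. -/
structure IsDPointMultiplier (φ : ℝ → ℂ) : Prop where
  locally_bv : ∃ δ : ℝ, 0 < δ ∧ BoundedVariationOn φ (Set.Ioo (-δ) δ)
  map_zero : φ 0 = 1
  integrable_mul : Integrable (fun x : ℝ => (x : ℂ) * φ x)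
  mem_wiener : MemWienerAlgebra φ
  differentiableAt : ∀ x : ℝ, x ≠ 0 → DifferentiableAt ℝ φ x
  mem_wiener_mul_deriv : MemWienerAlgebra (fun x : ℝ => (x : ℂ) * deriv φ x)
  integrable_mul_deriv : Integrable (fun x : ℝ => (x : ℂ) * deriv φ x)

/-- `x` is a `d`-point of `f` with value `d = d_f(x)`: the function `F(y) = ∫₀^y f(t) dt`
is differentiable at `x` with derivative `d`. -/
def IsDPoint (f : ℝ → ℂ) (x : ℝ) (d : ℂ) : Prop :=
  HasDerivAt (fun y : ℝ => ∫ t in (0 : ℝ)..y, f t) d x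

/-- The `k`-th term `c k * f̂_k * e^{ikx}` of the Fourier series of the `2π`-periodic function `f`
with multipliers `c`, where `f̂_k = (1/2π) ∫_{-π}^{π} f(t) e^{-ikt} dt`. -/
noncomputable def multiplierTerm (c : ℤ → ℂ) (f : ℝ → ℂ) (x : ℝ) (k : ℤ) : ℂ :=
  c k * fourierCoeffOn (neg_lt_self Real.pi_pos) f k *
    Complex.exp (Complex.I * (k : ℂ) * (x : ℂ))

/-!
The summation method is governed by `h(x) = x φ(x)`, whose derivative `χ = φ + x φ'` is integrable,
belongs to the Wiener algebra and has `χ(0) = 1`. Since `χ̂(t) = 2πi t ĥ(t)`, both `ĥ` and `t ĥ(t)`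
are integrable and `∫ χ̂ = 1`. Subtract from `f(x + ·)` its mean `c` and let `G` be the continuous
periodic primitive of the difference, so that the Fourier coefficients of `f(x + ·)` with `k ≠ 0`
are `i k Ĝ_k`. Then the multiplier series is `c + (i / ε) ∑ h(ε k) Ĝ_k`, and expanding `h` by
Fourier inversion turns it into
`c + (i / ε) ∫ ĥ(t) G(2π ε t) dt = c + ∫ χ̂(t) G(2π ε t) / (2π ε t) dt`.
As `G(0) = 0` and `G'(0) = d - c`, dominated convergence gives the limit `d`.

For `φ(x) = exp (-|x| ^ α)` the functions `φ` and `x φ'` are even, decay at infinity, and have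
second derivative `u''` on `(0, ∞)` with `x u''(x)` integrable. Integrating by parts twice against
`2 cos (2π t x) = v''(x)`, `v(x) = (sin (π t x) / (π t)) ^ 2`, and integrating the kernel in `t`
bounds `‖û‖₁` by a multiple of `‖x u''‖₁`, so `û` is integrable and `u` is in the Wiener algebra.
-/

open scoped FourierTransform ContDiff

section Fourier

variable {V E : Type*} [NormedAddCommGroup V] [InnerProductSpace ℝ V] [MeasurableSpace V]
  [BorelSpace V] [FiniteDimensional ℝ V] [NormedAddCommGroup E] [NormedSpace ℂ E]

theorem continuous_fourier {f : V → E} (hf : Integrable f) : Continuous (𝓕 f) :=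
  VectorFourier.fourierIntegral_continuous Real.continuous_fourierChar continuous_inner hf

variable [CompleteSpace E]

theorem integral_smul_fourier {f : V → ℂ} {g : V → E} (hf : Integrable f) (hg : Integrable g) :
    ∫ x, f x • 𝓕 g x = ∫ x, 𝓕 f x • g x := by
  refine Eq.trans ?_ (VectorFourier.integral_fourierIntegral_smul_eq_flip (L := innerₗ V)
    Real.continuous_fourierChar continuous_inner hf hg).symm
  rw [flip_innerₗ]
  rfl

theorem integral_smul_fourierInv {f : V → ℂ} {g : V → E} (hf : Integrable f) (hg : Integrable g) :
    ∫ x, f x • 𝓕⁻ g x = ∫ x, 𝓕⁻ f x • g x := by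
  calc ∫ x, f x • 𝓕⁻ g x = ∫ x, f (-x) • 𝓕 g x := by
        rw [← integral_neg_eq_self]
        simp only [Real.fourierInv_eq_fourier_neg, neg_neg]
    _ = ∫ x, 𝓕⁻ f x • g x := by
        rw [integral_smul_fourier hf.comp_neg hg, Real.fourierInv_eq_fourier_comp_neg]

theorem fourierInv_fourier_ae_eq {f : V → E} (hf : Integrable f) (hf' : Integrable (𝓕 f)) :
    𝓕⁻ (𝓕 f) =ᵐ[volume] f := by
  have hcont : Continuous (𝓕⁻ (𝓕 f)) := by
    rw [Real.fourierInv_eq_fourier_comp_neg]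
    exact continuous_fourier hf'.comp_neg
  refine ae_eq_of_integral_contDiff_smul_eq hcont.locallyIntegrable hf.locallyIntegrable
    fun u hu hsupp => ?_
  let v : SchwartzMap V ℂ := HasCompactSupport.toSchwartzMap (f := fun x => (u x : ℂ))
    (hsupp.comp_left Complex.ofReal_zero) (Complex.ofRealCLM.contDiff.comp hu)
  have hv : ∀ x, v x = u x := fun x => rfl
  calc ∫ x, u x • 𝓕⁻ (𝓕 f) x = ∫ x, v x • 𝓕⁻ (𝓕 f) x := by simp only [hv, Complex.coe_smul]
    _ = ∫ x, 𝓕⁻ (⇑v) x • 𝓕 f x := integral_smul_fourierInv v.integrable hf'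
    _ = ∫ x, 𝓕 (𝓕⁻ (⇑v)) x • f x := by
        rw [← SchwartzMap.fourierInv_coe]
        exact integral_smul_fourier (𝓕⁻ v).integrable hf
    _ = ∫ x, u x • f x := by
        rw [← SchwartzMap.fourierInv_coe, ← SchwartzMap.fourier_coe,
          FourierTransform.fourier_fourierInv_eq]
        simp only [hv, Complex.coe_smul]

end Fourier

theorem memWienerAlgebra_iff_exists_fourier {f : ℝ → ℂ} :
    MemWienerAlgebra f ↔ ∃ g : ℝ → ℂ, Integrable g ∧ f = 𝓕 g := by
  have h2π : 2 * π ≠ 0 := by positivity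
  have fourier_eq (g : ℝ → ℂ) (x : ℝ) :
      𝓕 g x = ∫ t, g t * cexp (-(I * (2 * π * t : ℝ) * x)) := by
    rw [Real.fourier_real_eq_integral_exp_smul]
    refine integral_congr_ae (ae_of_all _ fun t => ?_)
    simp only [smul_eq_mul]
    rw [mul_comm]
    push_cast
    ring_nf
  constructor
  · rintro ⟨g, hg, hfg⟩
    refine ⟨fun t => (2 * π) • g (2 * π * t), (hg.comp_mul_left' h2π).fun_smul _,
      funext fun x => ?_⟩
    have hsubst := Measure.integral_comp_mul_left (fun t => g t * cexp (-(I * t * x))) (2 * π)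
    simp only [fourier_eq, hfg, smul_mul_assoc, integral_smul, hsubst]
    rw [abs_of_pos (by positivity), smul_inv_smul₀ h2π]
  · rintro ⟨g, hg, rfl⟩
    refine ⟨fun t => (2 * π)⁻¹ • g ((2 * π)⁻¹ * t),
      (hg.comp_mul_left' (inv_ne_zero h2π)).fun_smul _, fun x => ?_⟩
    have hsubst := Measure.integral_comp_mul_left
      (fun t => g t * cexp (-(I * (2 * π * t : ℝ) * x))) (2 * π)⁻¹
    simp only [mul_inv_cancel_left₀ h2π, inv_inv] at hsubst
    simp only [fourier_eq, smul_mul_assoc, integral_smul, hsubst]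
    rw [abs_of_pos (by positivity), inv_smul_smul₀ h2π]

theorem MemWienerAlgebra.continuous {f : ℝ → ℂ} (hf : MemWienerAlgebra f) : Continuous f := by
  obtain ⟨g, hg, rfl⟩ := memWienerAlgebra_iff_exists_fourier.1 hf
  exact continuous_fourier hg

theorem MemWienerAlgebra.add {f₁ f₂ : ℝ → ℂ} (hf₁ : MemWienerAlgebra f₁)
    (hf₂ : MemWienerAlgebra f₂) : MemWienerAlgebra (f₁ + f₂) := by
  obtain ⟨g₁, hg₁, rfl⟩ := memWienerAlgebra_iff_exists_fourier.1 hf₁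
  obtain ⟨g₂, hg₂, rfl⟩ := memWienerAlgebra_iff_exists_fourier.1 hf₂
  exact memWienerAlgebra_iff_exists_fourier.2 ⟨g₁ + g₂, hg₁.add hg₂,
    (VectorFourier.fourierIntegral_add Real.continuous_fourierChar continuous_inner hg₁ hg₂).symm⟩

theorem MemWienerAlgebra.const_mul {f : ℝ → ℂ} (hf : MemWienerAlgebra f) (c : ℂ) :
    MemWienerAlgebra fun x => c * f x := by
  obtain ⟨g, hg, hfg⟩ := hf
  exact ⟨fun t => c * g t, hg.const_mul c, fun x => by
    simp only [hfg, mul_assoc, integral_const_mul]⟩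

theorem memWienerAlgebra_iff_integrable_fourier {f : ℝ → ℂ} (hf : Integrable f) :
    MemWienerAlgebra f ↔ Continuous f ∧ Integrable (𝓕 f) := by
  refine ⟨fun h => ⟨h.continuous, ?_⟩, fun ⟨hc, hf'⟩ => ?_⟩
  · obtain ⟨g, hg, rfl⟩ := memWienerAlgebra_iff_exists_fourier.1 h
    have hinv : Integrable (𝓕⁻ (𝓕 g)) := hg.congr (fourierInv_fourier_ae_eq hg hf).symm
    simpa only [Real.fourierInv_eq_fourier_neg, neg_neg] using hinv.comp_neg
  · refine memWienerAlgebra_iff_exists_fourier.2 ⟨fun t => 𝓕 f (-t), hf'.comp_neg, ?_⟩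
    rw [← Real.fourierInv_eq_fourier_comp_neg, hc.fourierInv_fourier_eq hf hf']

theorem integrable_of_norm_le_of_one_le_abs {E F : Type*} [NormedAddCommGroup E]
    [NormedAddCommGroup F] {f : ℝ → E} {g : ℝ → F} (hf : Continuous f) (hg : Integrable g)
    (hle : ∀ x, 1 ≤ |x| → ‖f x‖ ≤ ‖g x‖) : Integrable f := by
  have hfar : ∀ x ∈ (Set.Icc (-1 : ℝ) 1)ᶜ, ‖f x‖ ≤ ‖g x‖ := fun x hx =>
    hle x (not_le.1 fun h => hx (abs_le.1 h)).le
  rw [← integrableOn_univ, ← Set.union_compl_self (Set.Icc (-1 : ℝ) 1)]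
  exact hf.integrableOn_Icc.union (Integrable.mono hg.integrableOn hf.aestronglyMeasurable
    ((ae_restrict_iff' measurableSet_Icc.compl).2 (ae_of_all _ hfar)))

theorem integrable_fourier_of_integrable_fourier_deriv {f : ℝ → ℂ} (hf : Integrable f)
    (hdiff : Differentiable ℝ f) (hf' : Integrable (deriv f)) (hFf' : Integrable (𝓕 (deriv f))) :
    Integrable (𝓕 f) := by
  refine integrable_of_norm_le_of_one_le_abs (continuous_fourier hf) hFf' fun t ht => ?_
  have hfactor : 1 ≤ ‖2 * π * I * t‖ := by
    simp only [norm_mul, RCLike.norm_ofNat, norm_real, Real.norm_eq_abs, norm_I, abs_of_pos pi_pos]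
    nlinarith [pi_gt_three]
  rw [Real.fourier_deriv hf hdiff hf', norm_smul]
  exact le_mul_of_one_le_left (norm_nonneg _) hfactor

section SecondDerivative

open Set Asymptotics

variable {E : Type*} [NormedAddCommGroup E] [NormedSpace ℝ E]

theorem integral_eq_integral_Ioi_add_neg {g : ℝ → E} (hg : Integrable g) :
    ∫ x, g x = ∫ x in Ioi 0, (g x + g (-x)) := by
  have hneg : ∫ x in Ioi 0, g (-x) = ∫ x in Iic 0, g x := by
    simpa only [neg_zero] using integral_comp_neg_Ioi 0 g
  rw [integral_add hg.integrableOn hg.comp_neg.integrableOn, hneg, add_comm,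
    intervalIntegral.integral_Iic_add_Ioi hg.integrableOn hg.integrableOn]

theorem fourier_eq_integral_cos_of_even {f : ℝ → ℂ} (heven : Function.Even f)
    (hf : Integrable f) (t : ℝ) :
    𝓕 f t = ∫ s in Ioi 0, (2 * Real.cos (2 * (π * t) * s)) • f s := by
  have hint : Integrable fun s : ℝ => cexp (↑(-2 * π * s * t) * I) • f s :=
    hf.bdd_smul 1 (by fun_prop) (ae_of_all _ fun s => (norm_exp_ofReal_mul_I _).le)
  rw [Real.fourier_real_eq_integral_exp_smul, integral_eq_integral_Ioi_add_neg hint]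
  refine setIntegral_congr_fun measurableSet_Ioi fun s _ => ?_
  have hcos : ((2 * Real.cos (2 * (π * t) * s) : ℝ) : ℂ) =
      cexp (↑(-2 * π * s * t) * I) + cexp (↑(-2 * π * -s * t) * I) := by
    rw [Complex.ofReal_mul, Complex.ofReal_cos, Complex.cos, add_comm]
    push_cast
    ring_nf
  simp only [heven s, smul_eq_mul, Complex.real_smul, hcos, add_mul]

theorem integral_Ioi_of_hasDerivAt_of_tendsto_nhdsGT [CompleteSpace E] {F F' : ℝ → E} {a : ℝ}
    {l m : E} (hderiv : ∀ x ∈ Ioi a, HasDerivAt F (F' x) x) (hF' : IntegrableOn F' (Ioi a))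
    (hl : Tendsto F (𝓝[>] a) (𝓝 l)) (hm : Tendsto F atTop (𝓝 m)) :
    ∫ x in Ioi a, F' x = m - l := by
  have heq : ∀ x ≠ a, Function.update F a l x = F x := fun x hx => Function.update_of_ne hx l F
  rw [← Ici_sdiff_left] at hl
  simpa using integral_Ioi_of_hasDerivAt_of_tendsto (continuousWithinAt_update_same.2 hl)
    (fun x hx => (hderiv x hx).congr_of_eventuallyEq
      ((eventually_ne_nhds (ne_of_gt hx)).mono heq)) hF'
    (hm.congr' ((eventually_ne_atTop a).mono fun x hx => (heq x hx).symm))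

theorem integral_Ioi_deriv_deriv_smul_eq [CompleteSpace E] {v v' v'' : ℝ → ℝ} {f f' f'' : ℝ → E}
    {a : ℝ} (hv : ∀ s ∈ Ioi a, HasDerivAt v (v' s) s)
    (hv' : ∀ s ∈ Ioi a, HasDerivAt v' (v'' s) s) (hf : ∀ s ∈ Ioi a, HasDerivAt f (f' s) s)
    (hf' : ∀ s ∈ Ioi a, HasDerivAt f' (f'' s) s)
    (hint : IntegrableOn (fun s => v'' s • f s) (Ioi a))
    (hint' : IntegrableOn (fun s => v s • f'' s) (Ioi a))
    (hzero : Tendsto (fun s => v' s • f s - v s • f' s) (𝓝[>] a) (𝓝 0))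
    (htop : Tendsto (fun s => v' s • f s - v s • f' s) atTop (𝓝 0)) :
    ∫ s in Ioi a, v'' s • f s = ∫ s in Ioi a, v s • f'' s := by
  have hgreen := integral_Ioi_of_hasDerivAt_of_tendsto_nhdsGT
    (F' := fun s => v'' s • f s - v s • f'' s)
    (fun s hs => (((hv' s hs).smul (hf s hs)).sub ((hv s hs).smul (hf' s hs))).congr_deriv
      (by abel)) (hint.sub hint') hzero htop
  rwa [integral_sub hint hint', sub_zero, sub_eq_zero] at hgreen

theorem mul_sinc (x : ℝ) : x * sinc x = Real.sin x := by
  rcases eq_or_ne x 0 with rfl | hx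
  · simp
  · rw [sinc_of_ne_zero hx, mul_div_cancel₀ _ hx]

theorem integrableOn_mul_sinc_sq_smul {g : ℝ → E} {S : Set ℝ} (hg : IntegrableOn g S) {a : ℝ}
    (ha : a ≠ 0) : IntegrableOn (fun s => (s * sinc (a * s) ^ 2) • g s) S := by
  refine hg.bdd_smul |a|⁻¹ (by fun_prop) (ae_of_all _ fun s => ?_)
  have hker : s * sinc (a * s) ^ 2 = a⁻¹ * (Real.sin (a * s) * sinc (a * s)) := by
    rw [← mul_sinc (a * s)]
    field_simp
  rw [hker, Real.norm_eq_abs, abs_mul, abs_mul, abs_inv]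
  exact mul_le_of_le_one_right (by positivity)
    (mul_le_one₀ (Real.abs_sin_le_one _) (abs_nonneg _) (abs_sinc_le_one _))

theorem isBigO_sin_mul_id (l : Filter ℝ) (b : ℝ) :
    (fun s => Real.sin (b * s)) =O[l] fun s => s :=
  .of_bound |b| (.of_forall fun _ => abs_sin_le_abs.trans_eq (abs_mul _ _))

theorem isBigO_sin_mul_one (l : Filter ℝ) (b : ℝ) :
    (fun s => Real.sin (b * s)) =O[l] fun _ => (1 : ℝ) :=
  .of_bound 1 (.of_forall fun s => by simpa using abs_sin_le_one (b * s))

theorem integral_Ioi_cos_smul_eq [CompleteSpace E] {f f' f'' : ℝ → E} {a : ℝ} (ha : a ≠ 0)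
    (hf : IntegrableOn f (Ioi 0)) (hf'' : IntegrableOn (fun s => s • f'' s) (Ioi 0))
    (hderiv : ∀ s ∈ Ioi 0, HasDerivAt f (f' s) s)
    (hderiv' : ∀ s ∈ Ioi 0, HasDerivAt f' (f'' s) s)
    (hf_zero : Tendsto (fun s => s • f s) (𝓝[>] 0) (𝓝 0))
    (hf'_zero : Tendsto (fun s => s ^ 2 • f' s) (𝓝[>] 0) (𝓝 0))
    (hf_top : Tendsto f atTop (𝓝 0)) (hf'_top : Tendsto f' atTop (𝓝 0)) :
    ∫ s in Ioi 0, (2 * Real.cos (2 * a * s)) • f s =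
      ∫ s in Ioi 0, (s * sinc (a * s) ^ 2) • s • f'' s := by
  have hint : IntegrableOn (fun s => (2 * Real.cos (2 * a * s)) • f s) (Ioi 0) :=
    hf.bdd_smul 2 (by fun_prop) (ae_of_all _ fun s => by
      simpa using Real.abs_cos_le_one (2 * a * s))
  set v : ℝ → ℝ := fun s => (a⁻¹ * Real.sin (a * s)) ^ 2 with hv_def
  set v' : ℝ → ℝ := fun s => a⁻¹ * Real.sin (2 * a * s) with hv'_def
  have hker (s : ℝ) : (s * sinc (a * s) ^ 2) • s • f'' s = v s • f'' s := by
    rw [smul_smul, hv_def]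
    simp only [← mul_sinc (a * s)]
    congr 1
    field_simp
  have hv (s : ℝ) : HasDerivAt v (v' s) s := by
    refine ((((hasDerivAt_id s).const_mul a).sin.const_mul a⁻¹).pow 2).congr_deriv ?_
    simp only [hv'_def, id, Nat.cast_ofNat, Nat.reduceSub, pow_one, mul_assoc (2 : ℝ),
      Real.sin_two_mul]
    field_simp
  have hv' (s : ℝ) : HasDerivAt v' (2 * Real.cos (2 * a * s)) s := by
    refine (((hasDerivAt_id s).const_mul (2 * a)).sin.const_mul a⁻¹).congr_deriv ?_
    simp only [id]
    field_simp
  simp only [hker]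
  refine integral_Ioi_deriv_deriv_smul_eq (fun s _ => hv s) (fun s _ => hv' s) hderiv hderiv' hint
    ((integrableOn_mul_sinc_sq_smul hf'' ha).congr_fun (fun s _ => hker s) measurableSet_Ioi) ?_ ?_
  · have hv_zero : v =O[𝓝[>] 0] (· ^ 2) := ((isBigO_sin_mul_id _ a).const_mul_left a⁻¹).pow 2
    have hv'_zero : v' =O[𝓝[>] 0] id := (isBigO_sin_mul_id _ (2 * a)).const_mul_left a⁻¹
    simpa using ((hv'_zero.smul (isBigO_refl f _)).trans_tendsto hf_zero).sub
      ((hv_zero.smul (isBigO_refl f' _)).trans_tendsto hf'_zero)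
  · have hv_top : v =O[atTop] fun _ => (1 : ℝ) :=
      (((isBigO_sin_mul_one _ a).const_mul_left a⁻¹).pow 2).congr_right fun _ => one_pow 2
    have hv'_top : v' =O[atTop] fun _ => (1 : ℝ) :=
      (isBigO_sin_mul_one _ (2 * a)).const_mul_left a⁻¹
    simpa using ((hv'_top.smul (isBigO_refl f _)).trans_tendsto (by simpa using hf_top)).sub
      ((hv_top.smul (isBigO_refl f' _)).trans_tendsto (by simpa using hf'_top))

theorem integrable_sinc_sq : Integrable fun x : ℝ => sinc x ^ 2 := by
  refine (integrable_inv_one_add_sq.const_mul 2).mono' (by fun_prop) (ae_of_all _ fun x => ?_)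
  rw [Real.norm_eq_abs, abs_of_nonneg (sq_nonneg _), ← div_eq_mul_inv, le_div_iff₀ (by positivity)]
  calc sinc x ^ 2 * (1 + x ^ 2) = sinc x ^ 2 + Real.sin x ^ 2 := by rw [← mul_sinc]; ring
    _ ≤ 1 + 1 := add_le_add ((sq_le_one_iff_abs_le_one _).2 (abs_sinc_le_one x)) (sin_sq_le_one x)
    _ = 2 := one_add_one_eq_two

theorem integrable_integral_Ioi_mul_sinc_sq_smul {g : ℝ → E} (hg : IntegrableOn g (Ioi 0)) :
    Integrable fun t : ℝ => ∫ s in Ioi 0, (s * sinc (π * t * s) ^ 2) • g s := by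
  have hker {s : ℝ} (hs : 0 < s) : Integrable fun t : ℝ => s * sinc (π * t * s) ^ 2 := by
    have := (integrable_sinc_sq.comp_mul_left' (mul_pos pi_pos hs).ne').const_mul s
    simpa only [mul_right_comm] using this
  have hker_integral {s : ℝ} (hs : 0 < s) :
      ∫ t : ℝ, s * sinc (π * t * s) ^ 2 = π⁻¹ * ∫ x, sinc x ^ 2 := by
    simp only [mul_right_comm π _ s, integral_const_mul,
      Measure.integral_comp_mul_left (fun x => sinc x ^ 2) (π * s), smul_eq_mul]
    rw [abs_of_pos (by positivity)]
    field_simp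
  refine Integrable.integral_prod_left (μ := volume) (ν := volume.restrict (Ioi 0))
    (f := fun p : ℝ × ℝ => (p.2 * sinc (π * p.1 * p.2) ^ 2) • g p.2)
    ((integrable_prod_iff' ?_).2 ⟨?_, ?_⟩)
  · exact AEStronglyMeasurable.smul (by fun_prop) hg.aestronglyMeasurable.comp_snd
  · filter_upwards [ae_restrict_mem measurableSet_Ioi] with s hs
    exact (hker hs).smul_const _
  · refine (hg.norm.const_mul (π⁻¹ * ∫ x, sinc x ^ 2)).congr ?_
    filter_upwards [ae_restrict_mem measurableSet_Ioi] with s hs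
    have hpos (t : ℝ) : |s * sinc (π * t * s) ^ 2| = s * sinc (π * t * s) ^ 2 :=
      abs_of_nonneg (mul_nonneg (mem_Ioi.1 hs).le (sq_nonneg _))
    simp only [norm_smul, Real.norm_eq_abs, hpos, integral_mul_const, hker_integral hs]

end SecondDerivative

theorem integrable_fourier_of_even {f f' f'' : ℝ → ℂ} (heven : Function.Even f)
    (hf : Integrable f) (hf'' : IntegrableOn (fun s => s • f'' s) (Set.Ioi 0))
    (hderiv : ∀ s ∈ Set.Ioi 0, HasDerivAt f (f' s) s)
    (hderiv' : ∀ s ∈ Set.Ioi 0, HasDerivAt f' (f'' s) s)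
    (hf_zero : Tendsto (fun s => s • f s) (𝓝[>] 0) (𝓝 0))
    (hf'_zero : Tendsto (fun s => s ^ 2 • f' s) (𝓝[>] 0) (𝓝 0))
    (hf_top : Tendsto f atTop (𝓝 0)) (hf'_top : Tendsto f' atTop (𝓝 0)) :
    Integrable (𝓕 f) := by
  refine (integrable_integral_Ioi_mul_sinc_sq_smul hf'').congr ?_
  filter_upwards [Measure.ae_ne volume 0] with t ht
  rw [fourier_eq_integral_cos_of_even heven hf, integral_Ioi_cos_smul_eq (mul_ne_zero pi_ne_zero ht)
    hf.integrableOn hf'' hderiv hderiv' hf_zero hf'_zero hf_top hf'_top]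

/-- The function `|x| ^ p * exp (-|x| ^ α)`. The exponents `p = 0, 1, α` give `φ`, `|x φ(x)|` and
`-x φ'(x) / α` for `φ(x) = exp (-|x| ^ α)`, and on `(0, ∞)` the span of the family over all `p` is
closed under differentiation and under multiplication by powers of `x`. -/
noncomputable def stretchedExp (α p x : ℝ) : ℝ :=
  |x| ^ p * Real.exp (-|x| ^ α)

namespace stretchedExp

variable {α p x : ℝ}

theorem even (α p : ℝ) : Function.Even (stretchedExp α p) := fun x => by
  simp only [stretchedExp, abs_neg]

theorem comp_abs (α p x : ℝ) : stretchedExp α p |x| = stretchedExp α p x := by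
  simp only [stretchedExp, abs_abs]

theorem abs_mul_sub_one (hx : x ≠ 0) :
    |x| * stretchedExp α (p - 1) x = stretchedExp α p x := by
  rw [stretchedExp, stretchedExp, Real.rpow_sub_one (abs_ne_zero.2 hx), ← mul_assoc,
    mul_div_cancel₀ _ (abs_ne_zero.2 hx)]

theorem mul_sub_one (hx : 0 < x) : x * stretchedExp α (p - 1) x = stretchedExp α p x := by
  simpa only [abs_of_pos hx] using abs_mul_sub_one (α := α) (p := p) hx.ne'

theorem apply_zero (α : ℝ) (hp : p ≠ 0) : stretchedExp α p 0 = 0 := by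
  rw [stretchedExp, abs_zero, Real.zero_rpow hp, zero_mul]

theorem continuous (hα : 0 ≤ α) (hp : 0 ≤ p) : Continuous (stretchedExp α p) := by
  unfold stretchedExp
  exact (continuous_abs.rpow_const fun _ => Or.inr hp).mul
    (Real.continuous_exp.comp (continuous_abs.rpow_const fun _ => Or.inr hα).neg)

theorem tendsto_nhdsGT_zero (hα : 0 ≤ α) (hp : 0 < p) :
    Tendsto (stretchedExp α p) (𝓝[>] 0) (𝓝 0) :=
  ((continuous hα hp.le).tendsto' 0 0 (apply_zero α hp.ne')).mono_left nhdsWithin_le_nhds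

theorem tendsto_mul_nhdsGT_zero (hα : 0 ≤ α) (hp : 0 ≤ p) :
    Tendsto (fun s => s * stretchedExp α p s) (𝓝[>] 0) (𝓝 0) := by
  refine (tendsto_nhdsGT_zero (p := p + 1) hα (by linarith)).congr' ?_
  filter_upwards [self_mem_nhdsWithin] with s hs
  rw [← mul_sub_one (p := p + 1) hs, add_sub_cancel_right]

theorem tendsto_sq_mul_deriv_nhdsGT_zero (hα : 0 ≤ α) (hp : 0 ≤ p) :
    Tendsto (fun s => s ^ 2 * (p * stretchedExp α (p - 1) s - α * stretchedExp α (p + α - 1) s))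
      (𝓝[>] 0) (𝓝 0) := by
  have hlim := ((tendsto_mul_nhdsGT_zero hα hp).const_mul p).sub
    ((tendsto_mul_nhdsGT_zero hα (add_nonneg hp hα)).const_mul α)
  rw [mul_zero, mul_zero, sub_zero] at hlim
  refine hlim.congr' ?_
  filter_upwards [self_mem_nhdsWithin] with s hs
  rw [← mul_sub_one (p := p) hs, ← mul_sub_one (p := p + α) hs]
  ring

theorem tendsto_atTop (hα : 0 < α) : Tendsto (stretchedExp α p) atTop (𝓝 0) := by
  refine ((tendsto_rpow_mul_exp_neg_mul_atTop_nhds_zero (p / α) 1 one_pos).comp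
    (tendsto_rpow_atTop hα)).congr' ?_
  filter_upwards [eventually_gt_atTop 0] with x hx
  rw [Function.comp_apply, ← Real.rpow_mul hx.le, mul_div_cancel₀ p hα.ne', stretchedExp,
    abs_of_pos hx, neg_one_mul]

theorem hasDerivAt_of_pos (hx : 0 < x) : HasDerivAt (stretchedExp α p)
    (p * stretchedExp α (p - 1) x - α * stretchedExp α (p + α - 1) x) x := by
  have hpow (q : ℝ) : HasDerivAt (fun y : ℝ => y ^ q) (q * x ^ (q - 1)) x :=
    Real.hasDerivAt_rpow_const (Or.inl hx.ne')
  have hprod := (hpow p).mul (hpow α).neg.exp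
  refine (hprod.congr_of_eventuallyEq ?_).congr_deriv ?_
  · filter_upwards [eventually_gt_nhds hx] with y hy
    simp only [stretchedExp, abs_of_pos hy, Pi.mul_apply, Pi.neg_apply]
  · simp only [stretchedExp, abs_of_pos hx, Pi.neg_apply]
    rw [add_sub_assoc, Real.rpow_add hx]
    ring

theorem hasDerivAt_of_ne_zero (hx : x ≠ 0) : HasDerivAt (stretchedExp α p)
    ((p * stretchedExp α (p - 1) x - α * stretchedExp α (p + α - 1) x) * SignType.sign x) x := by
  have hcomp := (hasDerivAt_of_pos (α := α) (p := p) (abs_pos.2 hx)).comp x (hasDerivAt_abs hx)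
  simp only [comp_abs] at hcomp
  exact hcomp.congr_of_eventuallyEq (.of_forall fun y => (comp_abs α p y).symm)

theorem mul_deriv_zero (hα : α ≠ 0) (x : ℝ) :
    x * deriv (stretchedExp α 0) x = -α * stretchedExp α α x := by
  rcases eq_or_ne x 0 with rfl | hx
  · rw [apply_zero α hα, zero_mul, mul_zero]
  · rw [(hasDerivAt_of_ne_zero hx).deriv, mul_left_comm, self_mul_sign, zero_mul, zero_sub,
      zero_add, mul_comm, mul_neg, mul_left_comm, abs_mul_sub_one hx, neg_mul]

theorem integrableOn_Ioi (hα : 0 < α) (hp : -1 < p) :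
    IntegrableOn (stretchedExp α p) (Set.Ioi 0) :=
  (integrableOn_rpow_mul_exp_neg_rpow hp hα).congr_fun
    (fun x (hx : 0 < x) => by rw [stretchedExp, abs_of_pos hx]) measurableSet_Ioi

theorem integrable (hα : 0 < α) (hp : -1 < p) : Integrable (stretchedExp α p) := by
  have hIoi := integrableOn_Ioi hα hp
  have hIic : IntegrableOn (stretchedExp α p) (Set.Iic 0) := by
    have hneg := ((integrableOn_Ici_iff_integrableOn_Ioi (by simp)).2 hIoi).comp_neg
    simpa only [Set.neg_Ici, neg_zero, (even α p).eq] using hneg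
  rw [← integrableOn_univ, ← Set.Iic_union_Ioi (a := 0)]
  exact hIic.union hIoi

theorem integrable_mul_zero (hα : 0 < α) : Integrable fun x => x * stretchedExp α 0 x := by
  refine (integrable hα (p := 1) (by norm_num)).mono'
    (continuous_id.mul (continuous hα.le le_rfl)).aestronglyMeasurable
    (ae_of_all _ fun x => le_of_eq ?_)
  rw [stretchedExp, Real.rpow_zero, one_mul, norm_mul, Real.norm_eq_abs, Real.norm_eq_abs,
    Real.abs_exp, stretchedExp, Real.rpow_one]

theorem integrableOn_mul_deriv_deriv (hα : 0 < α) (hp : 0 ≤ p) : IntegrableOn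
    (fun s : ℝ => s *
      (p * ((p - 1) * stretchedExp α (p - 1 - 1) s - α * stretchedExp α (p - 1 + α - 1) s) -
        α * ((p + α - 1) * stretchedExp α (p + α - 1 - 1) s -
          α * stretchedExp α (p + α - 1 + α - 1) s))) (Set.Ioi 0) := by
  have hterm (c : ℝ) {q : ℝ} (hq : -1 < q) :
      IntegrableOn (fun s => c * stretchedExp α q s) (Set.Ioi 0) :=
    (integrableOn_Ioi hα hq).const_mul c
  have hfirst : IntegrableOn (fun s => (p * (p - 1)) * stretchedExp α (p - 1) s) (Set.Ioi 0) := by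
    rcases hp.eq_or_lt with rfl | hp
    · simpa only [zero_mul] using integrableOn_zero
    · exact hterm _ (by linarith)
  refine ((hfirst.add (hterm (-α * (2 * p + α - 1)) (q := p + α - 1) (by linarith))).add
    (hterm (α ^ 2) (q := p + α - 1 + α) (by linarith))).congr_fun (fun s hs => ?_) measurableSet_Ioi
  simp only [Pi.add_apply, mul_sub, mul_left_comm s, mul_sub_one hs, sub_add_eq_add_sub p 1 α]
  ring

theorem integrable_fourier (hα : 0 < α) (hp : 0 ≤ p) :
    Integrable (𝓕 fun x => (stretchedExp α p x : ℂ)) := by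
  have hderiv (q s : ℝ) (hs : s ∈ Set.Ioi 0) := hasDerivAt_of_pos (α := α) (p := q) hs
  have hderiv' (s : ℝ) (hs : s ∈ Set.Ioi 0) :=
    ((hderiv (p - 1) s hs).const_mul p).sub ((hderiv (p + α - 1) s hs).const_mul α)
  have htop (q : ℝ) := tendsto_atTop (p := q) hα
  have hderiv_top := ((htop (p - 1)).const_mul p).sub ((htop (p + α - 1)).const_mul α)
  rw [mul_zero, mul_zero, sub_zero] at hderiv_top
  have cast_tendsto {g : ℝ → ℝ} {l : Filter ℝ} (h : Tendsto g l (𝓝 0)) :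
      Tendsto (fun s => (g s : ℂ)) l (𝓝 0) := by
    simpa only [ofReal_zero] using h.ofReal
  refine integrable_fourier_of_even (fun x => congrArg ofReal (even α p x))
    (integrable hα (by linarith)).ofReal
    ?_ (fun s hs => (hderiv p s hs).ofReal_comp) (fun s hs => (hderiv' s hs).ofReal_comp)
    ?_ ?_ (cast_tendsto (htop p)) (cast_tendsto hderiv_top)
  · simp only [real_smul, ← ofReal_mul]
    exact (integrableOn_mul_deriv_deriv hα hp).ofReal
  · simpa only [real_smul, ← ofReal_mul] using cast_tendsto (tendsto_mul_nhdsGT_zero hα.le hp)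
  · simpa only [real_smul, ← ofReal_mul] using
      cast_tendsto (tendsto_sq_mul_deriv_nhdsGT_zero hα.le hp)

theorem memWienerAlgebra (hα : 0 < α) (hp : 0 ≤ p) :
    MemWienerAlgebra fun x => (stretchedExp α p x : ℂ) :=
  (memWienerAlgebra_iff_integrable_fourier (integrable hα (by linarith)).ofReal).2
    ⟨continuous_ofReal.comp (continuous hα.le hp), integrable_fourier hα hp⟩

theorem monotoneOn_zero (hα : 0 ≤ α) : MonotoneOn (stretchedExp α 0) (Set.Iic 0) := by
  intro x _ y (hy : y ≤ 0) hxy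
  simp only [stretchedExp, Real.rpow_zero, one_mul, abs_of_nonpos hy, abs_of_nonpos (hxy.trans hy)]
  have : 0 ≤ -y := neg_nonneg.2 hy
  gcongr

end stretchedExp

theorem boundedVariationOn_Icc_neg_of_even {E : Type*} [PseudoEMetricSpace E] {f : ℝ → E} {a : ℝ}
    (heven : Function.Even f) (hf : BoundedVariationOn f (Set.Icc (-a) 0)) (ha : 0 ≤ a) :
    BoundedVariationOn f (Set.Icc (-a) a) := by
  have hle : eVariationOn f (Set.Icc 0 a) ≤ eVariationOn f (Set.Icc (-a) 0) := by
    have h := eVariationOn.comp_le_of_antitoneOn f (t := Set.Icc 0 a) (s := Set.Icc (-a) 0) Neg.neg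
      (fun _ _ _ _ => neg_le_neg) fun x hx => ⟨neg_le_neg hx.2, neg_nonpos.2 hx.1⟩
    rwa [show f ∘ Neg.neg = f from funext heven] at h
  rw [← Set.Icc_union_Icc_eq_Icc (neg_nonpos.2 ha) ha, BoundedVariationOn,
    eVariationOn.union f (isGreatest_Icc (neg_nonpos.2 ha)) (isLeast_Icc ha)]
  exact ENNReal.add_ne_top.2 ⟨hf, ne_top_of_le_ne_top hf hle⟩

theorem isDPointMultiplier_stretchedExp {α : ℝ} (hα : 0 < α) :
    IsDPointMultiplier fun x => (stretchedExp α 0 x : ℂ) := by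
  have hdiff {x : ℝ} (hx : x ≠ 0) :=
    (stretchedExp.hasDerivAt_of_ne_zero (α := α) (p := 0) hx).differentiableAt
  have hmul_deriv : (fun x : ℝ => x * deriv (fun y => (stretchedExp α 0 y : ℂ)) x) =
      fun x => ((-α : ℝ) : ℂ) * (stretchedExp α α x : ℂ) := funext fun x => by
    rw [← ofReal_mul, ← stretchedExp.mul_deriv_zero hα.ne' x, ofReal_mul]
    rcases eq_or_ne x 0 with rfl | hx
    · rw [ofReal_zero, zero_mul, zero_mul]
    · rw [(hdiff hx).hasDerivAt.ofReal_comp.deriv]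
  refine ⟨⟨1, one_pos, ?_⟩, ?_, ?_, stretchedExp.memWienerAlgebra hα le_rfl,
    fun x hx => (hdiff hx).hasDerivAt.ofReal_comp.differentiableAt, ?_, ?_⟩
  · have hleft := ((stretchedExp.monotoneOn_zero hα.le).mono
      (Set.Icc_subset_Iic_self (a := -1))).locallyBoundedVariationOn (-1) 0 (by simp) (by simp)
    rw [Set.inter_self] at hleft
    exact (isometry_ofReal.lipschitz.comp_boundedVariationOn
      (boundedVariationOn_Icc_neg_of_even (stretchedExp.even α 0) hleft zero_le_one)).mono
        Set.Ioo_subset_Icc_self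
  · rw [stretchedExp, abs_zero, Real.rpow_zero, Real.zero_rpow hα.ne', neg_zero, Real.exp_zero,
      one_mul, ofReal_one]
  · simp only [← ofReal_mul]
    exact (stretchedExp.integrable_mul_zero hα).ofReal
  · rw [hmul_deriv]
    exact (stretchedExp.memWienerAlgebra hα hα.le).const_mul _
  · rw [hmul_deriv]
    exact (stretchedExp.integrable hα (by linarith)).ofReal.const_mul _

theorem norm_le_intervalIntegral_norm_add_norm_deriv {E : Type*} [NormedAddCommGroup E]
    [NormedSpace ℝ E] [CompleteSpace E] {f : ℝ → E} (hf : Integrable f) (hdiff : Differentiable ℝ f)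
    (hf' : Integrable (deriv f)) (a : ℝ) :
    ‖f a‖ ≤ ∫ t in a..a + 1, (‖f t‖ + ‖deriv f t‖) := by
  have ha : a ≤ a + 1 := by linarith
  have hf'_int (c d : ℝ) : IntervalIntegrable (fun t => ‖deriv f t‖) volume c d :=
    hf'.norm.intervalIntegrable
  have hpointwise : ∀ t ∈ Set.Icc a (a + 1),
      ‖f a‖ - (∫ s in a..a + 1, ‖deriv f s‖) ≤ ‖f t‖ := fun t ht => by
    have hsub : ‖f t - f a‖ ≤ ∫ s in a..t, ‖deriv f s‖ := by
      rw [← intervalIntegral.integral_deriv_eq_sub (fun s _ => hdiff s) hf'.intervalIntegrable]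
      exact intervalIntegral.norm_integral_le_integral_norm ht.1
    have hmono : ∫ s in a..t, ‖deriv f s‖ ≤ ∫ s in a..a + 1, ‖deriv f s‖ :=
      intervalIntegral.integral_mono_interval le_rfl ht.1 ht.2
        (ae_of_all _ fun s => norm_nonneg _) (hf'_int _ _)
    have htri := norm_sub_norm_le (f a) (f t)
    rw [norm_sub_rev] at htri
    linarith
  have hmean := intervalIntegral.integral_mono_on ha intervalIntegrable_const
    hf.norm.intervalIntegrable hpointwise
  rw [intervalIntegral.integral_const, add_sub_cancel_left, one_smul] at hmean
  rw [intervalIntegral.integral_add hf.norm.intervalIntegrable (hf'_int _ _)]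
  linarith

theorem summable_norm_intCast {E : Type*} [NormedAddCommGroup E] [NormedSpace ℝ E]
    [CompleteSpace E] {f : ℝ → E} (hf : Integrable f) (hdiff : Differentiable ℝ f)
    (hf' : Integrable (deriv f)) : Summable fun k : ℤ => ‖f k‖ := by
  refine ((hf.norm.add hf'.norm).hasSum_intervalIntegral 0).summable.of_nonneg_of_le
    (fun k => norm_nonneg _) fun k => ?_
  rw [zero_add]
  exact norm_le_intervalIntegral_norm_add_norm_deriv hf hdiff hf' k

theorem summable_norm_mul_intCast {E : Type*} [NormedAddCommGroup E] [NormedSpace ℝ E]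
    [CompleteSpace E] {f : ℝ → E} (hf : Integrable f) (hdiff : Differentiable ℝ f)
    (hf' : Integrable (deriv f)) {ε : ℝ} (hε : ε ≠ 0) : Summable fun k : ℤ => ‖f (ε * k)‖ := by
  refine summable_norm_intCast (f := fun x => f (ε * x)) (hf.comp_mul_left' hε)
    (hdiff.comp (differentiable_id.const_mul ε)) ?_
  have hderiv : deriv (fun x => f (ε * x)) = fun x => ε • deriv f (ε * x) :=
    funext fun x => deriv_comp_mul_left ε f x
  rw [hderiv]
  exact (hf'.comp_mul_left' hε).smul ε

theorem integrable_mul_comp {Ω X : Type*} [TopologicalSpace Ω] [MeasurableSpace Ω]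
    [OpensMeasurableSpace Ω] [TopologicalSpace X] [CompactSpace X] {μ : Measure Ω} {m : Ω → ℂ}
    (hm : Integrable m μ) (u : C(Ω, X)) (G : C(X, ℂ)) : Integrable (fun t => m t * G (u t)) μ :=
  hm.mul_bdd (c := ‖G‖) (G.continuous.comp u.continuous).aestronglyMeasurable
    (ae_of_all _ fun t => G.norm_coe_le_norm (u t))

theorem norm_integral_mul_comp_le {Ω X : Type*} [TopologicalSpace Ω] [MeasurableSpace Ω]
    [TopologicalSpace X] [CompactSpace X] {μ : Measure Ω} {m : Ω → ℂ}
    (hm : Integrable m μ) (u : C(Ω, X)) (G : C(X, ℂ)) :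
    ‖∫ t, m t * G (u t) ∂μ‖ ≤ (∫ t, ‖m t‖ ∂μ) * ‖G‖ := by
  rw [← integral_mul_const]
  refine norm_integral_le_of_norm_le (hm.norm.mul_const _) (ae_of_all _ fun t => ?_)
  rw [norm_mul]
  gcongr
  exact G.norm_coe_le_norm (u t)

/-- Integration of continuous functions on a compact space, pulled back along `u`, against an
integrable weight `m`, as a continuous linear functional. -/
noncomputable def integralMulComp {Ω X : Type*} [TopologicalSpace Ω] [MeasurableSpace Ω]
    [OpensMeasurableSpace Ω] [TopologicalSpace X] [CompactSpace X] {μ : Measure Ω} {m : Ω → ℂ}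
    (hm : Integrable m μ) (u : C(Ω, X)) : C(X, ℂ) →L[ℂ] ℂ :=
  LinearMap.mkContinuous
    { toFun := fun G => ∫ t, m t * G (u t) ∂μ
      map_add' := fun G₁ G₂ => by
        simp only [ContinuousMap.add_apply, mul_add,
          integral_add (integrable_mul_comp hm u G₁) (integrable_mul_comp hm u G₂)]
      map_smul' := fun c G => by
        simp only [ContinuousMap.smul_apply, smul_eq_mul, mul_left_comm _ c, integral_const_mul,
          RingHom.id_apply] }
    (∫ t, ‖m t‖ ∂μ) (norm_integral_mul_comp_le hm u)

theorem norm_integralMulComp_le {Ω X : Type*} [TopologicalSpace Ω] [MeasurableSpace Ω]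
    [OpensMeasurableSpace Ω] [TopologicalSpace X] [CompactSpace X] {μ : Measure Ω} {m : Ω → ℂ}
    (hm : Integrable m μ) (u : C(Ω, X)) : ‖integralMulComp hm u‖ ≤ ∫ t, ‖m t‖ ∂μ :=
  LinearMap.mkContinuous_norm_le _ (integral_nonneg fun _ => norm_nonneg _)
    (norm_integral_mul_comp_le hm u)

section AddCircle

variable {T : ℝ} [hT : Fact (0 < T)]

theorem integrable_fourier_haarAddCircle (k : ℤ) :
    Integrable (fourier k : AddCircle T → ℂ) AddCircle.haarAddCircle :=
  (fourier k).continuous.integrable_of_hasCompactSupport (HasCompactSupport.of_compactSpace _)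

/-- The `k`-th Fourier coefficient as a continuous linear functional on `C(AddCircle T, ℂ)`. -/
noncomputable def fourierCoeffCLM (k : ℤ) : C(AddCircle T, ℂ) →L[ℂ] ℂ :=
  integralMulComp (integrable_fourier_haarAddCircle (-k)) (ContinuousMap.id _)

theorem norm_fourierCoeffCLM_le (k : ℤ) :
    ‖(fourierCoeffCLM k : C(AddCircle T, ℂ) →L[ℂ] ℂ)‖ ≤ 1 := by
  refine (norm_integralMulComp_le _ _).trans_eq ?_
  simp only [fourier_apply, Circle.norm_coe, integral_const, probReal_univ, one_smul]

theorem summable_smul_fourierCoeffCLM {c : ℤ → ℂ} (hc : Summable fun k => ‖c k‖) :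
    Summable fun k => c k • (fourierCoeffCLM k : C(AddCircle T, ℂ) →L[ℂ] ℂ) := by
  refine hc.of_norm_bounded fun k => ?_
  rw [norm_smul]
  exact mul_le_of_le_one_right (norm_nonneg _) (norm_fourierCoeffCLM_le k)

theorem hasSum_mul_fourierCoeff {c : ℤ → ℂ} (hc : Summable fun k => ‖c k‖)
    (G : C(AddCircle T, ℂ)) :
    HasSum (fun k => c k * fourierCoeff G k)
      ((∑' k, c k • fourierCoeffCLM k : C(AddCircle T, ℂ) →L[ℂ] ℂ) G) :=
  (summable_smul_fourierCoeffCLM hc).hasSum.mapL (ContinuousLinearMap.apply ℂ ℂ G)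

theorem hasSum_fourierInv_mul_fourierCoeff {m : ℝ → ℂ} (hm : Integrable m) {ε : ℝ}
    (hs : Summable fun k : ℤ => ‖𝓕⁻ m (ε * k)‖) (G : C(AddCircle T, ℂ)) :
    HasSum (fun k : ℤ => 𝓕⁻ m (ε * k) * fourierCoeff G k)
      (∫ t, m t * G ((ε * T * t : ℝ) : AddCircle T)) := by
  let u : C(ℝ, AddCircle T) :=
    ⟨fun t => (ε * T * t : ℝ), (AddCircle.continuous_mk' T).comp (continuous_const_mul _)⟩
  suffices (∑' k : ℤ, 𝓕⁻ m (ε * k) • fourierCoeffCLM k) = integralMulComp hm u by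
    have h := hasSum_mul_fourierCoeff hs G
    rwa [this] at h
  refine ContinuousLinearMap.ext_on
    (Submodule.dense_iff_topologicalClosure_eq_top.2 span_fourier_closure_eq_top) ?_
  rintro _ ⟨n, rfl⟩
  have hsingle := hasSum_single
    (f := fun k : ℤ => 𝓕⁻ m (ε * k) * fourierCoeff (@fourier T n) k) n fun k hk => by
      rw [fourierCoeff_fourier, Pi.single_eq_of_ne hk, mul_zero]
  rw [(hasSum_mul_fourierCoeff hs (fourier n)).unique hsingle, fourierCoeff_fourier,
    Pi.single_eq_same, mul_one, Real.fourierInv_eq']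
  change _ = ∫ t, m t * fourier n ((ε * T * t : ℝ) : AddCircle T)
  refine integral_congr_ae (ae_of_all _ fun t => ?_)
  have hT0 : (T : ℂ) ≠ 0 := ofReal_ne_zero.2 hT.out.ne'
  simp only [fourier_coe_apply, smul_eq_mul]
  rw [mul_comm (m t)]
  congr 2
  simp only [RCLike.inner_apply, conj_trivial]
  push_cast
  field_simp

end AddCircle

theorem tendsto_integral_mul_comp_mul {ρ K : ℝ → ℂ} (hρ : Integrable ρ) (hK : Continuous K)
    {C : ℝ} (hC : ∀ x, ‖K x‖ ≤ C) :
    Tendsto (fun ε => ∫ t, ρ t * K (ε * t)) (𝓝 0) (𝓝 ((∫ t, ρ t) * K 0)) := by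
  rw [← integral_mul_const]
  refine tendsto_integral_filter_of_dominated_convergence (fun t => ‖ρ t‖ * C)
    (.of_forall fun ε => hρ.aestronglyMeasurable.mul
      (hK.comp (continuous_const_mul ε)).aestronglyMeasurable)
    (.of_forall fun ε => ae_of_all _ fun t => ?_) (hρ.norm.mul_const C) (ae_of_all _ fun t => ?_)
  · rw [norm_mul]
    gcongr
    exact hC _
  · refine ((hK.comp (continuous_mul_const t)).tendsto' 0 (K 0) ?_).const_mul (ρ t)
    rw [Function.comp_apply, zero_mul]

theorem continuous_dslope {E : Type*} [NormedAddCommGroup E] [NormedSpace ℝ E] {f : ℝ → E}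
    {a : ℝ} (hf : Continuous f) (hfa : DifferentiableAt ℝ f a) : Continuous (dslope f a) := by
  rw [← continuousOn_univ, continuousOn_dslope univ_mem]
  exact ⟨hf.continuousOn, hfa⟩

theorem exists_norm_dslope_le {E : Type*} [NormedAddCommGroup E] [NormedSpace ℝ E] {f : ℝ → E}
    {a C : ℝ} (hf : Continuous f) (hfa : DifferentiableAt ℝ f a) (hC : ∀ x, ‖f x‖ ≤ C) :
    ∃ B, ∀ x, ‖dslope f a x‖ ≤ B := by
  obtain ⟨B, hB⟩ := (isCompact_closedBall a 1).exists_bound_of_continuousOn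
    (continuous_dslope hf hfa).continuousOn
  refine ⟨max B (C + C), fun x => ?_⟩
  rcases le_or_gt (dist x a) 1 with hx | hx
  · exact (hB x hx).trans (le_max_left _ _)
  · refine le_trans ?_ (le_max_right _ _)
    rw [Real.dist_eq] at hx
    calc ‖dslope f a x‖ ≤ ‖(x - a) • dslope f a x‖ := by
          rw [norm_smul]
          exact le_mul_of_one_le_left (norm_nonneg _) hx.le
      _ = ‖f x - f a‖ := by rw [sub_smul_dslope]
      _ ≤ C + C := (norm_sub_le _ _).trans (add_le_add (hC x) (hC a))

theorem intervalIntegral_mul_intervalIntegral_swap {a b : ℝ} (hab : a ≤ b) {w g : ℝ → ℂ}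
    (hw : IntervalIntegrable w volume a b) (hg : IntervalIntegrable g volume a b) :
    ∫ u in a..b, w u * ∫ t in a..u, g t = ∫ t in a..b, (∫ u in t..b, w u) * g t := by
  have hwg := ((intervalIntegrable_iff_integrableOn_Ioc_of_le hab).1 hw).mul_prod
    ((intervalIntegrable_iff_integrableOn_Ioc_of_le hab).1 hg)
  have hswap := integral_integral_swap
    (f := fun u t => {p : ℝ × ℝ | p.2 ≤ p.1}.indicator (fun p => w p.1 * g p.2) (u, t))
    (hwg.indicator (measurableSet_le measurable_snd measurable_fst))
  rw [intervalIntegral.integral_of_le hab, intervalIntegral.integral_of_le hab]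
  convert hswap using 1
  · refine setIntegral_congr_fun measurableSet_Ioc fun u hu => ?_
    change _ = ∫ t in Set.Ioc a b, (Set.Iic u).indicator (fun t => w u * g t) t
    rw [setIntegral_indicator measurableSet_Iic, Set.Ioc_inter_Iic, min_eq_right hu.2,
      integral_const_mul, ← intervalIntegral.integral_of_le hu.1.le]
  · refine setIntegral_congr_fun measurableSet_Ioc fun t ht => ?_
    change _ = ∫ u in Set.Ioc a b, (Set.Ici t).indicator (fun u => w u * g t) u
    have hset : Set.Ioc a b ∩ Set.Ici t = Set.Icc t b := by
      ext u
      exact ⟨fun hu => ⟨hu.2, hu.1.2⟩, fun hu => ⟨⟨ht.1.trans_le hu.1, hu.2⟩, hu.1⟩⟩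
    rw [setIntegral_indicator measurableSet_Ici, hset, integral_Icc_eq_integral_Ioc,
      integral_mul_const, ← intervalIntegral.integral_of_le ht.2]

theorem exists_primitive_sub_const {T : ℝ} (hT : T ≠ 0) {f : ℝ → ℂ} (hper : Function.Periodic f T)
    (hf : ∀ a b, IntervalIntegrable f volume a b) :
    ∃ (c : ℂ) (G : C(AddCircle T, ℂ)), ∀ y : ℝ, G y = ∫ t in 0..y, (f t - c) := by
  let c : ℂ := (T : ℂ)⁻¹ * ∫ t in 0..T, f t
  have hsub (a b : ℝ) : IntervalIntegrable (fun t => f t - c) volume a b :=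
    (hf a b).sub intervalIntegrable_const
  have hmean : ∫ t in 0..T, (f t - c) = 0 := by
    rw [intervalIntegral.integral_sub (hf _ _) intervalIntegrable_const,
      intervalIntegral.integral_const, sub_zero, Complex.real_smul,
      mul_inv_cancel_left₀ (ofReal_ne_zero.2 hT), sub_self]
  have hG : Function.Periodic (fun y : ℝ => ∫ t in 0..y, (f t - c)) T := fun y => by
    have hstep := (hper.comp (· - c)).intervalIntegral_add_eq y 0
    simp only [Function.comp_apply] at hstep
    rw [zero_add, hmean] at hstep
    dsimp only
    rw [← intervalIntegral.integral_add_adjacent_intervals (hsub 0 y) (hsub y _), hstep, add_zero]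
  exact ⟨c, ⟨hG.lift, continuous_coinduced_dom.2 (intervalIntegral.continuous_primitive hsub 0)⟩,
    fun y => rfl⟩

theorem continuous_fourier_coe {T : ℝ} (k : ℤ) :
    Continuous fun y : ℝ => fourier k (y : AddCircle T) :=
  (fourier k).continuous.comp (AddCircle.continuous_mk' T)

section AddCircle

variable {T : ℝ} [hT : Fact (0 < T)]

theorem intervalIntegral_fourier_neg {k : ℤ} (hk : k ≠ 0) :
    ∫ y in 0..T, fourier (-k) (y : AddCircle T) = 0 := by
  rw [intervalIntegral.integral_eq_sub_of_hasDerivAt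
    (fun y _ => has_antideriv_at_fourier_neg hT hk y)
    ((continuous_fourier_coe (-k)).intervalIntegrable _ _), AddCircle.coe_period,
    QuotientAddGroup.mk_zero, sub_self]

theorem mul_fourierCoeff_primitive {g : ℝ → ℂ} (hg : IntervalIntegrable g volume 0 T)
    {G : C(AddCircle T, ℂ)} (hG : ∀ y : ℝ, G y = ∫ t in 0..y, g t) (k : ℤ) :
    2 * π * I * k / T * fourierCoeff G k
      = (T : ℂ)⁻¹ * ∫ y in 0..T, fourier (-k) (y : AddCircle T) * g y := by
  have hmean : ∫ t in 0..T, g t = 0 := by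
    rw [← hG, AddCircle.coe_period, ← AddCircle.coe_zero, hG, intervalIntegral.integral_same]
  have hcont := continuous_fourier_coe (T := T) (-k)
  have hderiv (t : ℝ) : ∫ u in t..T, -2 * π * I * k / T * fourier (-k) (u : AddCircle T)
      = 1 - fourier (-k) (t : AddCircle T) := by
    rw [intervalIntegral.integral_eq_sub_of_hasDerivAt (fun u _ => hasDerivAt_fourier_neg T k u)
      ((hcont.const_mul _).intervalIntegrable _ _), AddCircle.coe_period, fourier_eval_zero]
  have hswap := intervalIntegral_mul_intervalIntegral_swap hT.out.le
    ((hcont.const_mul (-2 * π * I * k / T)).intervalIntegrable 0 T) hg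
  simp only [hderiv, ← hG, sub_mul, one_mul, mul_assoc _ (fourier (-k) _)] at hswap
  rw [intervalIntegral.integral_sub hg (hg.continuousOn_mul hcont.continuousOn), hmean, zero_sub,
    intervalIntegral.integral_const_mul] at hswap
  rw [fourierCoeff_eq_intervalIntegral _ k 0, zero_add, Complex.real_smul]
  simp only [smul_eq_mul]
  rw [← neg_inj, ← mul_neg (T : ℂ)⁻¹, ← hswap, one_div, ofReal_inv]
  ring

end AddCircle

instance : Fact (0 < 2 * π) := ⟨two_pi_pos⟩

theorem summable_multiplierTerm {a : ℤ → ℂ} (ha : Summable fun k => ‖a k‖) (f : ℝ → ℂ) (x : ℝ) :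
    Summable (multiplierTerm a f x) := by
  refine (ha.mul_right (|1 / (π - -π)| * ∫ t in (-π)..π, ‖f t‖)).of_norm_bounded fun k => ?_
  have hexp : ‖cexp (I * k * x)‖ = 1 := by
    rw [show I * k * x = ((k * x : ℝ) : ℂ) * I by push_cast; ring, norm_exp_ofReal_mul_I]
  rw [multiplierTerm, norm_mul, norm_mul, hexp, mul_one, fourierCoeffOn_eq_integral, norm_smul,
    Real.norm_eq_abs]
  gcongr
  refine (intervalIntegral.norm_integral_le_integral_norm (neg_lt_self pi_pos).le).trans_eq ?_
  simp only [smul_eq_mul, norm_mul, fourier_apply, Circle.norm_coe, one_mul]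

theorem multiplierTerm_eq_intervalIntegral {f : ℝ → ℂ} (hper : Function.Periodic f (2 * π))
    (a : ℤ → ℂ) (x : ℝ) (k : ℤ) :
    multiplierTerm a f x k = a k *
      (((2 * π : ℝ) : ℂ)⁻¹ *
        ∫ y in 0..2 * π, fourier (-k) (y : AddCircle (2 * π)) * f (x + y)) := by
  let F : ℝ → ℂ := fun t => fourier (-k) ((t - x : ℝ) : AddCircle (2 * π)) * f t
  have hF : Function.Periodic F (2 * π) := fun t => by
    simp only [F, hper t, add_sub_right_comm t, AddCircle.coe_add_period]
  have hcharacter (t : ℝ) : fourier (-k) (t : AddCircle (π - -π)) * f t * cexp (I * k * x)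
      = F t := by
    have hpi : (π : ℂ) ≠ 0 := ofReal_ne_zero.2 pi_ne_zero
    simp only [F, fourier_coe_apply]
    rw [mul_right_comm, ← Complex.exp_add]
    congr 2
    push_cast
    field_simp
    ring
  have hshift : ∫ y in 0..2 * π, fourier (-k) (y : AddCircle (2 * π)) * f (x + y)
      = ∫ t in (-π)..π, F t := by
    have htranslate := intervalIntegral.integral_comp_add_left (a := 0) (b := 2 * π) F x
    simp only [F, add_sub_cancel_left, add_zero] at htranslate
    rw [htranslate, hF.intervalIntegral_add_eq x (-π), neg_add_eq_sub, two_mul,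
      add_sub_cancel_right]
  rw [hshift, multiplierTerm, fourierCoeffOn_eq_integral, Complex.real_smul, mul_assoc, mul_assoc,
    ← intervalIntegral.integral_mul_const]
  simp only [smul_eq_mul, hcharacter, sub_neg_eq_add, ← two_mul, one_div, ofReal_inv]

theorem multiplierTerm_eq_add_mul_fourierCoeff {f : ℝ → ℂ} (hper : Function.Periodic f (2 * π))
    (hf : ∀ a b, IntervalIntegrable f volume a b) {x : ℝ} {c : ℂ} {G : C(AddCircle (2 * π), ℂ)}
    (hG : ∀ y : ℝ, G y = ∫ t in 0..y, (f (x + t) - c)) (a : ℤ → ℂ) (k : ℤ) :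
    multiplierTerm a f x k = (if k = 0 then a 0 * c else 0) + I * (k * a k * fourierCoeff G k) := by
  have hfx : IntervalIntegrable (fun y => f (x + y)) volume 0 (2 * π) := by
    simpa using (hf x (x + 2 * π)).comp_add_left x
  have hpi : ((2 * π : ℝ) : ℂ) ≠ 0 := ofReal_ne_zero.2 two_pi_pos.ne'
  have hcont := continuous_fourier_coe (T := 2 * π) (-k)
  have hcoeff := mul_fourierCoeff_primitive (hfx.sub intervalIntegrable_const) hG k
  simp only [mul_sub] at hcoeff
  rw [intervalIntegral.integral_sub (hfx.continuousOn_mul hcont.continuousOn)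
    ((hcont.intervalIntegrable _ _).mul_const c), intervalIntegral.integral_mul_const,
    mul_sub, eq_sub_iff_add_eq] at hcoeff
  rw [multiplierTerm_eq_intervalIntegral hper, ← hcoeff]
  split_ifs with hk
  · subst hk
    simp only [neg_zero, fourier_zero, intervalIntegral.integral_const, sub_zero, Complex.real_smul,
      mul_one, inv_mul_cancel_left₀ hpi, Int.cast_zero, mul_zero, zero_div, zero_mul, zero_add,
      add_zero]
  · rw [intervalIntegral_fourier_neg hk]
    push_cast at hpi ⊢
    field_simp
    ring

theorem IsDPoint.hasDerivAt_integral_sub_const {f : ℝ → ℂ} {x : ℝ} {d : ℂ}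
    (hd : IsDPoint f x d) (hf : ∀ a b, IntervalIntegrable f volume a b) (c : ℂ) :
    HasDerivAt (fun y => ∫ t in 0..y, (f (x + t) - c)) (d - c) 0 := by
  have hshift : HasDerivAt (fun y => ∫ t in 0..x + y, f t) d 0 :=
    HasDerivAt.comp_const_add x 0 (by rwa [add_zero])
  have hlinear : HasDerivAt (fun y : ℝ => y • c) c 0 := by
    simpa using (hasDerivAt_id' (0 : ℝ)).smul_const c
  refine ((hshift.sub_const (∫ t in 0..x, f t)).sub hlinear).congr_of_eventuallyEq
    (.of_forall fun y => ?_)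
  have hfx : IntervalIntegrable (fun t => f (x + t)) volume 0 y := by
    simpa using (hf x (x + y)).comp_add_left x
  dsimp only [Pi.sub_apply]
  rw [intervalIntegral.integral_sub hfx intervalIntegrable_const,
    intervalIntegral.integral_const, sub_zero,
    intervalIntegral.integral_interval_sub_left (hf _ _) (hf _ _),
    intervalIntegral.integral_comp_add_left, add_zero]

namespace IsDPointMultiplier

variable {φ : ℝ → ℂ}

theorem integrable (hφ : IsDPointMultiplier φ) : Integrable φ :=
  integrable_of_norm_le_of_one_le_abs hφ.mem_wiener.continuous hφ.integrable_mul fun x hx => by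
    rw [norm_mul, norm_real]
    exact le_mul_of_one_le_left (norm_nonneg _) hx

theorem hasDerivAt_mul (hφ : IsDPointMultiplier φ) (x : ℝ) :
    HasDerivAt (fun y : ℝ => (y : ℂ) * φ y) (φ x + x * deriv φ x) x := by
  rcases eq_or_ne x 0 with rfl | hx
  · rw [ofReal_zero, zero_mul, add_zero, hasDerivAt_iff_tendsto_slope]
    refine (hφ.mem_wiener.continuous.tendsto 0).mono_left nhdsWithin_le_nhds |>.congr' ?_
    filter_upwards [self_mem_nhdsWithin] with y hy
    rw [slope_def_module, sub_zero, ofReal_zero, zero_mul, sub_zero, ← Complex.real_smul,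
      inv_smul_smul₀ hy]
  · simpa only [one_mul, ofReal_one] using!
      (hasDerivAt_id' x).ofReal_comp.mul (hφ.differentiableAt x hx).hasDerivAt

theorem differentiable_mul (hφ : IsDPointMultiplier φ) :
    Differentiable ℝ fun x : ℝ => (x : ℂ) * φ x :=
  fun x => (hφ.hasDerivAt_mul x).differentiableAt

theorem deriv_mul (hφ : IsDPointMultiplier φ) :
    deriv (fun x : ℝ => (x : ℂ) * φ x) = fun x : ℝ => φ x + x * deriv φ x :=
  funext fun x => (hφ.hasDerivAt_mul x).deriv

theorem integrable_deriv_mul (hφ : IsDPointMultiplier φ) :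
    Integrable (deriv fun x : ℝ => (x : ℂ) * φ x) := by
  rw [hφ.deriv_mul]
  exact hφ.integrable.add hφ.integrable_mul_deriv

theorem memWienerAlgebra_deriv_mul (hφ : IsDPointMultiplier φ) :
    MemWienerAlgebra (deriv fun x : ℝ => (x : ℂ) * φ x) := by
  rw [hφ.deriv_mul]
  exact hφ.mem_wiener.add hφ.mem_wiener_mul_deriv

theorem integrable_fourier_deriv_mul (hφ : IsDPointMultiplier φ) :
    Integrable (𝓕 (deriv fun x : ℝ => (x : ℂ) * φ x)) :=
  ((memWienerAlgebra_iff_integrable_fourier hφ.integrable_deriv_mul).1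
    hφ.memWienerAlgebra_deriv_mul).2

theorem integrable_fourier_mul (hφ : IsDPointMultiplier φ) :
    Integrable (𝓕 fun x : ℝ => (x : ℂ) * φ x) :=
  integrable_fourier_of_integrable_fourier_deriv hφ.integrable_mul hφ.differentiable_mul
    hφ.integrable_deriv_mul hφ.integrable_fourier_deriv_mul

theorem fourierInv_fourier_mul (hφ : IsDPointMultiplier φ) :
    𝓕⁻ (𝓕 fun x : ℝ => (x : ℂ) * φ x) = fun x : ℝ => (x : ℂ) * φ x :=
  hφ.differentiable_mul.continuous.fourierInv_fourier_eq hφ.integrable_mul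
    hφ.integrable_fourier_mul

theorem integral_fourier_deriv_mul (hφ : IsDPointMultiplier φ) :
    ∫ t, 𝓕 (deriv fun x : ℝ => (x : ℂ) * φ x) t = 1 := by
  have hinv := congrFun (hφ.memWienerAlgebra_deriv_mul.continuous.fourierInv_fourier_eq
    hφ.integrable_deriv_mul hφ.integrable_fourier_deriv_mul) 0
  rw [Real.fourierInv_eq'] at hinv
  simpa [hφ.deriv_mul, hφ.map_zero] using hinv

theorem summable_norm_mul (hφ : IsDPointMultiplier φ) {ε : ℝ} (hε : ε ≠ 0) :
    Summable fun k : ℤ => ‖((ε * k : ℝ) : ℂ) * φ (ε * k)‖ :=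
  summable_norm_mul_intCast hφ.integrable_mul hφ.differentiable_mul hφ.integrable_deriv_mul hε

theorem summable_norm (hφ : IsDPointMultiplier φ) {ε : ℝ} (hε : ε ≠ 0) :
    Summable fun k : ℤ => ‖φ (ε * k)‖ := by
  refine .of_norm_bounded_eventually ((hφ.summable_norm_mul hε).mul_left |ε|⁻¹) ?_
  filter_upwards [(Set.finite_singleton (0 : ℤ)).compl_mem_cofinite] with k hk
  have hk1 : (1 : ℝ) ≤ |(k : ℝ)| := by exact_mod_cast Int.one_le_abs hk
  rw [norm_norm, norm_mul, norm_real, Real.norm_eq_abs, abs_mul, mul_assoc,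
    inv_mul_cancel_left₀ (abs_ne_zero.2 hε)]
  exact le_mul_of_one_le_left (norm_nonneg _) hk1

theorem summable_multiplierTerm (hφ : IsDPointMultiplier φ) {ε : ℝ} (hε : ε ≠ 0) (f : ℝ → ℂ)
    (x : ℝ) : Summable (multiplierTerm (fun k : ℤ => φ (ε * k)) f x) :=
  _root_.summable_multiplierTerm (hφ.summable_norm hε) f x

theorem tsum_multiplierTerm_eq_add_integral (hφ : IsDPointMultiplier φ) {ε : ℝ} (hε : ε ≠ 0)
    {f : ℝ → ℂ} (hper : Function.Periodic f (2 * π))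
    (hf : ∀ a b, IntervalIntegrable f volume a b) {x : ℝ} {c : ℂ} {G : C(AddCircle (2 * π), ℂ)}
    (hG : ∀ y : ℝ, G y = ∫ t in 0..y, (f (x + t) - c)) :
    ∑' k, multiplierTerm (fun k : ℤ => φ (ε * k)) f x k
      = c + ∫ t, 𝓕 (deriv fun x : ℝ => (x : ℂ) * φ x) t *
          dslope (fun y : ℝ => G (y : AddCircle (2 * π))) 0 (2 * π * (ε * t)) := by
  have hsum := hasSum_fourierInv_mul_fourierCoeff (T := 2 * π) hφ.integrable_fourier_mul (ε := ε)
    (by simpa only [hφ.fourierInv_fourier_mul] using hφ.summable_norm_mul hε) G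
  simp only [hφ.fourierInv_fourier_mul] at hsum
  have hε' : (ε : ℂ) ≠ 0 := ofReal_ne_zero.2 hε
  have hterm (k : ℤ) : multiplierTerm (fun k : ℤ => φ (ε * k)) f x k
      = (if k = 0 then c else 0) + I / ε * (((ε * k : ℝ) : ℂ) * φ (ε * k) * fourierCoeff G k) := by
    rw [multiplierTerm_eq_add_mul_fourierCoeff hper hf hG, Int.cast_zero, mul_zero, hφ.map_zero,
      one_mul]
    congr 1
    push_cast
    field_simp
  simp only [hterm]
  rw [((hasSum_ite_eq (0 : ℤ) c).add (hsum.mul_left (I / ε))).tsum_eq, ← integral_const_mul]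
  congr 2 with t
  have hslope := sub_smul_dslope (fun y : ℝ => G (y : AddCircle (2 * π))) 0 (2 * π * (ε * t))
  have hG0 : G ((0 : ℝ) : AddCircle (2 * π)) = 0 := by
    rw [hG, intervalIntegral.integral_same]
  rw [hG0, sub_zero, sub_zero] at hslope
  rw [Real.fourier_deriv hφ.integrable_mul hφ.differentiable_mul hφ.integrable_deriv_mul,
    mul_comm ε (2 * π), mul_assoc (2 * π) ε t, ← hslope]
  simp only [smul_eq_mul, Complex.real_smul]
  push_cast
  field_simp

theorem tendsto_tsum_multiplierTerm (hφ : IsDPointMultiplier φ) {f : ℝ → ℂ}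
    (hper : Function.Periodic f (2 * π)) (hf : IntervalIntegrable f volume (-π) π) {x : ℝ} {d : ℂ}
    (hd : IsDPoint f x d) :
    Tendsto (fun ε : ℝ => ∑' k, multiplierTerm (fun k : ℤ => φ (ε * k)) f x k)
      (𝓝[≠] 0) (𝓝 d) := by
  have hfi : ∀ a b, IntervalIntegrable f volume a b :=
    hper.intervalIntegrable two_pi_pos.ne' (t := -π) (by convert hf using 1; ring)
  obtain ⟨c, G, hG⟩ := exists_primitive_sub_const two_pi_pos.ne'
    (f := fun t => f (x + t)) (fun t => by simp only [← add_assoc, hper (x + t)])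
    fun a b => by simpa using (hfi (x + a) (x + b)).comp_add_left x
  let g : ℝ → ℂ := fun y => G (y : AddCircle (2 * π))
  have hgcont : Continuous g := G.continuous.comp (AddCircle.continuous_mk' _)
  have hgderiv : HasDerivAt g (d - c) 0 := by
    rw [show g = _ from funext hG]
    exact hd.hasDerivAt_integral_sub_const hfi c
  obtain ⟨B, hB⟩ := exists_norm_dslope_le hgcont hgderiv.differentiableAt
    fun y => G.norm_coe_le_norm y
  have hlim := (tendsto_integral_mul_comp_mul hφ.integrable_fourier_deriv_mul
    (K := fun y => dslope g 0 (2 * π * y))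
    ((continuous_dslope hgcont hgderiv.differentiableAt).comp (continuous_const_mul _))
    fun y => hB _).const_add c
  rw [hφ.integral_fourier_deriv_mul, mul_zero, dslope_same, hgderiv.deriv, one_mul,
    add_sub_cancel] at hlim
  refine (hlim.mono_left nhdsWithin_le_nhds).congr' ?_
  filter_upwards [self_mem_nhdsWithin] with ε hε
  exact (hφ.tsum_multiplierTerm_eq_add_integral hε hper hfi hG).symm

end IsDPointMultiplier

theorem mainTheorem9 (α : ℝ) (hα : 0 < α) (φ : ℝ → ℂ)
    (hφ : ∀ x : ℝ, φ x = ((Real.exp (-(|x| ^ α)) : ℝ) : ℂ)) :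
    IsDPointMultiplier φ ∧
    ∀ f : ℝ → ℂ, Function.Periodic f (2 * Real.pi) →
      IntervalIntegrable f volume (-Real.pi) Real.pi →
      ∀ (x : ℝ) (d : ℂ), IsDPoint f x d →
        ((∀ n : ℕ, Summable (multiplierTerm (fun k : ℤ => φ ((k : ℝ) / ((n : ℝ) + 1))) f x)) ∧
          Tendsto
            (fun n : ℕ => ∑' k : ℤ, multiplierTerm (fun k : ℤ => φ ((k : ℝ) / ((n : ℝ) + 1))) f x k)
            atTop (𝓝 d)) ∧
        ((∀ ε : ℝ, 0 < ε → Summable (multiplierTerm (fun k : ℤ => φ (ε * (k : ℝ))) f x)) ∧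
          Tendsto
            (fun ε : ℝ => ∑' k : ℤ, multiplierTerm (fun k : ℤ => φ (ε * (k : ℝ))) f x k)
            (𝓝[>] 0) (𝓝 d)) := by
  have hmult : IsDPointMultiplier φ := by
    convert isDPointMultiplier_stretchedExp hα using 2 with x
    rw [hφ, stretchedExp, Real.rpow_zero, one_mul]
  refine ⟨hmult, fun f hper hf x d hd => ?_⟩
  have hlim := (hmult.tendsto_tsum_multiplierTerm hper hf hd).mono_left (nhdsGT_le_nhdsNE 0)
  have hinv : Tendsto (fun n : ℕ => 1 / ((n : ℝ) + 1)) atTop (𝓝[>] 0) :=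
    tendsto_nhdsWithin_iff.2 ⟨tendsto_one_div_add_atTop_nhds_zero_nat,
      .of_forall fun n => Set.mem_Ioi.2 Nat.one_div_pos_of_nat⟩
  have hdiv (n : ℕ) : (fun k : ℤ => φ ((k : ℝ) / ((n : ℝ) + 1)))
      = fun k : ℤ => φ (1 / ((n : ℝ) + 1) * k) :=
    funext fun k => by rw [one_div_mul_eq_div]
  simp only [hdiv]
  exact ⟨⟨fun n => hmult.summable_multiplierTerm Nat.one_div_pos_of_nat.ne' f x, hlim.comp hinv⟩,
    fun ε hε => hmult.summable_multiplierTerm hε.ne' f x, hlim⟩
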